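/- Let $E_{10}$ be the complex Kac--Moody algebra with simple roots $\alpha_{-1},\alpha_0,\dots,\alpha_8$ whose Dynkin diagram is the chain $\alpha_{-1}-\alpha_0-\cdots-\alpha_7$ together with the node $\alpha_8$ joined to $\alpha_5$ only, given by Chevalley generators and Serre relations. Identify the dual $\mathfrak h^*$ of its ($10$-dimensional real) Cartan subalgebra with $\mathbb R^{10}$ by $$\alpha_{-1}=(1,-1,0,\dots,0),\quad \alpha_0=(0,1,-1,0,\dots,0),\quad \dots,\quad \alpha_7=(0,\dots,0,1,-1),\quad \alpha_8=(0,\dots,0,1,1,1),$$ so that the inner product is $(n|n')=\sum_i n_in_i'-\frac19\bigl(\sum_i n_i\bigr)\bigl(\sum_i n_i'\bigr)$. A root is a nonzero $\alpha\in\mathfrak h^*$ with nonzero root space; it is positive if it is a combination of the simple roots with non-negative integer coefficients, real if some element of the Weyl group (generated by the simple reflections) maps it to a simple root, and imaginary otherwise. The void count of $\alpha=(n_1,\dots,n_{10})$ is the number of indices $i$ with $n_i=0$. Then the positive imaginary roots of $E_{10}$ with void count $>0$ are exactly the vectors obtained by permuting the coordinates of $$(0,n,n,n,n,n,n,n,n,n),\qquad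 n\in\mathbb Z,\ n>0.$$ -/

import Mathlib

noncomputable section

namespace Eten

/-- The Cartan matrix of `E₁₀`. The indices `0, …, 8` are the nodes `α₋₁, α₀, …, α₇` of a chain,
and the index `9` is the node `α₈`, which is joined to `α₅` (index `6`) only. -/
def cartanMatrix : Matrix (Fin 10) (Fin 10) ℤ :=
  !![ 2, -1,  0,  0,  0,  0,  0,  0,  0,  0;
     -1,  2, -1,  0,  0,  0,  0,  0,  0,  0;
      0, -1,  2, -1,  0,  0,  0,  0,  0,  0;
      0,  0, -1,  2, -1,  0,  0,  0,  0,  0;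
      0,  0,  0, -1,  2, -1,  0,  0,  0,  0;
      0,  0,  0,  0, -1,  2, -1,  0,  0,  0;
      0,  0,  0,  0,  0, -1,  2, -1,  0, -1;
      0,  0,  0,  0,  0,  0, -1,  2, -1,  0;
      0,  0,  0,  0,  0,  0,  0, -1,  2,  0;
      0,  0,  0,  0,  0,  0, -1,  0,  0,  2]

/-- The Kac-Moody algebra `E₁₀`: the complex Lie algebra on Chevalley generators `H i`, `E i`,
`F i` with the Serre relations. As the Cartan matrix is invertible, the `H i` (the simple coroots)
form a basis of the Cartan subalgebra. -/
abbrev Algebra : Type := Matrix.ToLieAlgebra ℂ cartanMatrix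

/-- The generator `H i` of `E₁₀`, that is, the simple coroot as an element of the algebra. -/
def H (i : Fin 10) : Algebra :=
  LieSubmodule.Quotient.mk (N := CartanMatrix.Relations.toIdeal ℂ cartanMatrix)
    (FreeLieAlgebra.of ℂ (CartanMatrix.Generators.H i))

/-- The dual `𝔥*` of the real Cartan subalgebra, in "physical" coordinates `(n₁, …, n₁₀)`
(the coordinate `nⱼ` has index `j - 1`). -/
abbrev Dual : Type := Fin 10 → ℝ

/-- The simple roots in physical coordinates: `α₋₁ = (1, -1, 0, …, 0)`, …,
`α₇ = (0, …, 0, 1, -1)`, `α₈ = (0, …, 0, 1, 1, 1)`. -/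
def simpleRootInt : Fin 10 → Fin 10 → ℤ :=
  ![![1, -1,  0,  0,  0,  0,  0,  0,  0,  0],
    ![0,  1, -1,  0,  0,  0,  0,  0,  0,  0],
    ![0,  0,  1, -1,  0,  0,  0,  0,  0,  0],
    ![0,  0,  0,  1, -1,  0,  0,  0,  0,  0],
    ![0,  0,  0,  0,  1, -1,  0,  0,  0,  0],
    ![0,  0,  0,  0,  0,  1, -1,  0,  0,  0],
    ![0,  0,  0,  0,  0,  0,  1, -1,  0,  0],
    ![0,  0,  0,  0,  0,  0,  0,  1, -1,  0],
    ![0,  0,  0,  0,  0,  0,  0,  0,  1, -1],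
    ![0,  0,  0,  0,  0,  0,  0,  1,  1,  1]]

/-- The simple roots as elements of `𝔥*`. -/
def simpleRoot (i : Fin 10) : Dual := fun j => (simpleRootInt i j : ℝ)

/-- The Cartan inner product `∑ nᵢ nᵢ' - (1/9) (∑ nᵢ) (∑ nᵢ')` on `𝔥*`. -/
def form (a b : Dual) : ℝ := ∑ i, a i * b i - (1 / 9) * (∑ i, a i) * (∑ i, b i)

/-- The simple coroot `αᵢ^∨`, as the functional `λ ↦ λ(αᵢ^∨)` on `𝔥*`. As all simple roots have
square `2`, this is the inner product with `αᵢ`. -/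
def coroot (i : Fin 10) : Dual →ₗ[ℝ] ℝ where
  toFun a := form a (simpleRoot i)
  map_add' a b := by
    simp only [form, Pi.add_apply, add_mul, Finset.sum_add_distrib]; ring
  map_smul' c a := by
    simp only [form, Pi.smul_apply, smul_eq_mul, mul_assoc, ← Finset.mul_sum, RingHom.id_apply]
    ring

/-- The defining property of the simple roots and coroots: `αⱼ(αᵢ^∨) = aᵢⱼ`. -/
theorem coroot_simpleRoot (i j : Fin 10) :
    coroot i (simpleRoot j) = (cartanMatrix i j : ℝ) := by
  have key : ∀ i j : Fin 10,
      9 * ∑ k, simpleRootInt j k * simpleRootInt i k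
        - (∑ k, simpleRootInt j k) * (∑ k, simpleRootInt i k) = 9 * cartanMatrix i j := by
    decide
  have h : (9 * ∑ k, (simpleRootInt j k : ℝ) * simpleRootInt i k
        - (∑ k, (simpleRootInt j k : ℝ)) * (∑ k, (simpleRootInt i k : ℝ)))
        = 9 * (cartanMatrix i j : ℝ) := by
    exact_mod_cast key i j
  change ∑ k, (simpleRootInt j k : ℝ) * simpleRootInt i k
    - (1 / 9) * (∑ k, (simpleRootInt j k : ℝ)) * (∑ k, (simpleRootInt i k : ℝ)) = _
  linarith

theorem coroot_simpleRoot_self (i : Fin 10) : coroot i (simpleRoot i) = 2 := by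
  have h : ∀ i, cartanMatrix i i = 2 := by decide
  rw [coroot_simpleRoot, h i]; norm_num

/-- The root space of `a ∈ 𝔥*`: all `x` with `⁅h, x⁆ = a(h) x` for every
`h = ∑ cᵢ αᵢ^∨` in the Cartan subalgebra. -/
def rootSpace (a : Dual) : Submodule ℂ Algebra where
  carrier := {x | ∀ c : Fin 10 → ℝ,
    ⁅∑ i, (c i : ℂ) • H i, x⁆ = ((∑ i, c i * coroot i a : ℝ) : ℂ) • x}
  zero_mem' c := by simp
  add_mem' hx hy c := by rw [lie_add, hx c, hy c, smul_add]
  smul_mem' r x hx c := by rw [lie_smul, hx c, smul_comm]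

/-- Roots: nonzero elements of `𝔥*` with a nonzero root space. -/
def IsRoot (a : Dual) : Prop := a ≠ 0 ∧ rootSpace a ≠ ⊥

/-- Positive roots: the roots that are combinations of simple roots with natural coefficients. -/
def IsPositiveRoot (a : Dual) : Prop :=
  IsRoot a ∧ ∃ k : Fin 10 → ℕ, a = ∑ i, k i • simpleRoot i

/-- The simple reflection `rᵢ(λ) = λ - λ(αᵢ^∨) αᵢ`. -/
def simpleReflection (i : Fin 10) : Dual ≃ₗ[ℝ] Dual :=
  Module.reflection (coroot_simpleRoot_self i)

/-- The Weyl group. -/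
def weylGroup : Subgroup (Dual ≃ₗ[ℝ] Dual) :=
  Subgroup.closure (Set.range simpleReflection)

/-- Real roots: the roots that some Weyl group element maps to a simple root. -/
def IsRealRoot (a : Dual) : Prop :=
  IsRoot a ∧ ∃ w ∈ weylGroup, ∃ i, w a = simpleRoot i

/-- Imaginary roots: the roots that are not real. -/
def IsImaginaryRoot (a : Dual) : Prop := IsRoot a ∧ ¬ IsRealRoot a

/-- The void count: the number of indices `i` with `nᵢ = 0`. -/
def voidCount (a : Dual) : ℕ := Set.ncard {i | a i = 0}

end Eten

end

noncomputable section

namespace Eten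

-- If `a j = 0` and `S = ∑ nᵢ`, then `(a|a)` is the sum of `(nᵢ - S/9)²` over the nine indices `i ≠
-- j`. The form is thus positive semidefinite on each coordinate hyperplane, and its null vectors
-- there have nine equal entries (`eq_of_form_nonpos`). A positive imaginary root has nonpositive
-- square (`form_nonpos_of_isImaginaryRoot`), so one with a void is such a null vector; the root
-- lattice and positivity make the common entry a positive integer.
--
-- Conversely, put `δ = (0, 1, …, 1)`. A product of simple reflections fixes `δ` and sends `-α₅` to
-- `δ - α₅`, so every `nδ - α₅` is a root. The `α₅`-string through it contains `nδ` (`isRoot_null`).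
-- The first nine simple reflections permute the coordinates, so all permutations of `nδ` are roots;
-- their square is `0`, whereas real roots have square `2`.
--
-- The Lie-theoretic input is derived from the presentation. Every root is, up to sign, the sum of
-- the letters of a nonvanishing iterated bracket (`weight_eq`). The Serre relations make `ad (E i)`
-- and `ad (F i)` locally nilpotent, which gives `sl₂` strings and Weyl invariance
-- (`pow_lower_ne_zero`). Finally `E i ≠ 0`, so that roots exist at all, because the generators act
-- nontrivially on an explicit highest weight module (`toIdeal_le_ker_rep`, `eQuot_ne_zero`).

attribute [local instance 100] LieRing.ofAssociativeRing

/-! ### Weight strings for `sl₂` -/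

section SlTwo

variable {V : Type*} [AddCommGroup V] [Module ℂ V] {e h f : Module.End ℂ V}

/-- Moving `f` to the left past the `k + 1` copies of `e` produces `h` acting with weights `μ, μ +
2, …, μ + 2k`, whose sum is `(k + 1)(μ + k)`. -/
theorem pow_apply_lower (hef : ∀ y, e (f y) = f (e y) + h y)
    (hhe : ∀ y, h (e y) = e (h y) + (2 : ℂ) • e y) (k : ℕ) {μ : ℂ} {x : V} (hx : h x = μ • x) :
    (e ^ (k + 1)) (f x) = f ((e ^ (k + 1)) x) + ((k + 1) * (μ + k)) • (e ^ k) x := by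
  have hw : ∀ n : ℕ, h ((e ^ n) x) = (μ + 2 * n) • (e ^ n) x := by
    intro n
    induction n with
    | zero => simp [hx]
    | succ n ih =>
      rw [pow_succ', Module.End.mul_apply, hhe, ih, map_smul, ← add_smul]
      push_cast
      congr 1
      ring
  induction k with
  | zero => simp [hef, hx]
  | succ k ih =>
    rw [pow_succ' e (k + 1), Module.End.mul_apply, ih, map_add, hef, hw, map_smul,
      Module.End.mul_apply, ← Module.End.mul_apply e (e ^ k), ← pow_succ', add_assoc, ← add_smul]
    push_cast
    congr 2
    ring

/-- Induction on `n`: passing from `x` to `f x` replaces `(μ, k)` by `(μ - 2, k + 1)`, and `e ^ (k +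
1)` maps `f x` to a multiple of `e ^ k x`. -/
theorem pow_apply_pow_lower (hef : ∀ y, e (f y) = f (e y) + h y)
    (hhe : ∀ y, h (e y) = e (h y) + (2 : ℂ) • e y)
    (hhf : ∀ y, h (f y) = f (h y) - (2 : ℂ) • f y) (n k : ℕ) {μ : ℂ} {x : V}
    (hx : h x = μ • x) (hk : (e ^ (k + 1)) x = 0) :
    (e ^ (n + k)) ((f ^ n) x) =
      (∏ s ∈ Finset.range n, ((k + 1 + s) * (μ - s + k) : ℂ)) • (e ^ k) x := by
  induction n generalizing k μ x with
  | zero => simp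
  | succ n ih =>
    have hc := pow_apply_lower hef hhe k hx
    rw [hk, map_zero, zero_add] at hc
    have hc' : (e ^ (k + 1 + 1)) (f x) = 0 := by
      rw [pow_succ', Module.End.mul_apply, hc, map_smul, ← Module.End.mul_apply, ← pow_succ', hk,
        smul_zero]
    have hfx : h (f x) = (μ - 2) • f x := by rw [hhf, hx, map_smul, sub_smul]
    have := ih (k + 1) hfx hc'
    rw [pow_succ f, Module.End.mul_apply, show n + 1 + k = n + (k + 1) by ring, this, hc, smul_smul,
      Finset.prod_range_succ']
    congr 1
    push_cast
    congr 1
    · refine Finset.prod_congr rfl fun s _ => ?_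
      ring
    · ring

/-- In a representation of `sl₂`, the lowering operator can be applied `m` times to a vector of
weight `m` which the raising operator kills eventually. -/
theorem pow_lower_ne_zero (hef : ∀ y, e (f y) = f (e y) + h y)
    (hhe : ∀ y, h (e y) = e (h y) + (2 : ℂ) • e y)
    (hhf : ∀ y, h (f y) = f (h y) - (2 : ℂ) • f y) {m n : ℕ} {x : V}
    (hx : h x = (m : ℂ) • x) (hx0 : x ≠ 0) (hnil : ∃ k : ℕ, (e ^ k) x = 0) (hn : n ≤ m) :
    (f ^ n) x ≠ 0 := by
  obtain ⟨k, hk, hk'⟩ := Nat.exists_not_and_succ_of_not_zero_of_exists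
    (p := fun k => (e ^ k) x = 0) (by simpa using hx0) hnil
  intro h0
  have := pow_apply_pow_lower hef hhe hhf n k hx hk'
  rw [h0, map_zero, eq_comm, smul_eq_zero_iff_left hk, Finset.prod_eq_zero_iff] at this
  obtain ⟨s, hs, h⟩ := this
  have hs := Finset.mem_range.1 hs
  -- Since `s < n ≤ m`, both factors `k + 1 + s` and `m - s + k` are positive integers.
  obtain ⟨d, rfl⟩ : ∃ d, m = s + 1 + d := ⟨m - (s + 1), by omega⟩
  rcases mul_eq_zero.1 h with h | h
  · exact absurd h (by exact_mod_cast (by omega : k + 1 + s ≠ 0))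
  · have : ((1 + d + k : ℕ) : ℂ) = 0 := by rw [← h]; push_cast; ring
    exact absurd this (by exact_mod_cast (by omega : 1 + d + k ≠ 0))

end SlTwo

/-! ### Triangular decomposition and weights of a Lie algebra with Chevalley generators -/

section Chevalley

variable {ι L : Type*} [LieRing L] [LieAlgebra ℂ L]

/-- Iterated brackets `⁅e i₁, ⁅e i₂, ⁅…, e iₙ⁆⁆⁆`. -/
def lieWord (e : ι → L) : List ι → L
  -- With the value `0` here, a nonvanishing bracket always comes from a nonempty word.
  | [] => 0
  | [i] => e i
  | i :: j :: w => ⁅e i, lieWord e (j :: w)⁆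

theorem lie_lieWord_mem (e : ι → L) (i : ι) (w : List ι) :
    ⁅e i, lieWord e w⁆ ∈ Submodule.span ℂ (Set.range (lieWord e)) := by
  cases w with
  | nil => simp [lieWord]
  | cons j w => exact Submodule.subset_span ⟨i :: j :: w, rfl⟩

omit [LieAlgebra ℂ L] in
-- The innermost bracket of a longer word in one letter is `⁅e i, e i⁆ = 0`. This excludes proper
-- multiples of simple roots.
theorem eq_singleton_of_lieWord_ne_zero (e : ι → L) (i : ι) {w : List ι}
    (hw : lieWord e w ≠ 0) (h : ∀ j ∈ w, j = i) : w = [i] := by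
  induction w with
  | nil => simp [lieWord] at hw
  | cons j w ih =>
    obtain rfl : j = i := h j (by simp)
    cases w with
    | nil => rfl
    | cons l w =>
      rw [lieWord] at hw
      have h0 : lieWord e (l :: w) ≠ 0 := fun h0 => hw (by rw [h0, lie_zero])
      rw [ih h0 fun a ha => h a (List.mem_cons_of_mem _ ha)] at hw
      simp [lieWord] at hw

section Span

variable {e h f : ι → L}

/-- The span of the iterated brackets and of the elements `h i`; it is all of a Lie algebra
generated by the family. -/
def triangularSpan (e h f : ι → L) : Submodule ℂ L :=
  Submodule.span ℂ (Set.range (lieWord e)) ⊔ Submodule.span ℂ (Set.range h) ⊔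
    Submodule.span ℂ (Set.range (lieWord f))

theorem triangularSpan_swap : triangularSpan f (-h) e = triangularSpan e h f := by
  have : Submodule.span ℂ (Set.range (-h)) = Submodule.span ℂ (Set.range h) := by
    have hr : Set.range (-h) = -Set.range h := by
      ext x
      simp [neg_eq_iff_eq_neg]
    rw [hr, Submodule.span_neg]
  rw [triangularSpan, triangularSpan, this]
  ac_rfl

theorem lieWord_mem_triangularSpan (w : List ι) : lieWord e w ∈ triangularSpan e h f :=
  Submodule.mem_sup_left (Submodule.mem_sup_left (Submodule.subset_span ⟨w, rfl⟩))

theorem h_mem_triangularSpan (i : ι) : h i ∈ triangularSpan e h f :=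
  Submodule.mem_sup_left (Submodule.mem_sup_right (Submodule.subset_span ⟨i, rfl⟩))

theorem lieWord_mem_triangularSpan' (w : List ι) : lieWord f w ∈ triangularSpan e h f :=
  Submodule.mem_sup_right (Submodule.subset_span ⟨w, rfl⟩)

theorem lie_mem_triangularSpan_of_forall {x : L}
    (he : ∀ w, ⁅x, lieWord e w⁆ ∈ triangularSpan e h f)
    (hh : ∀ i, ⁅x, h i⁆ ∈ triangularSpan e h f)
    (hf : ∀ w, ⁅x, lieWord f w⁆ ∈ triangularSpan e h f) {y : L} (hy : y ∈ triangularSpan e h f) :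
    ⁅x, y⁆ ∈ triangularSpan e h f := by
  have : triangularSpan e h f ≤
      (triangularSpan e h f).comap (LieAlgebra.ad ℂ L x : L →ₗ[ℂ] L) := by
    refine sup_le (sup_le ?_ ?_) ?_
    all_goals
      rw [Submodule.span_le]
      rintro _ ⟨w, rfl⟩
    · exact he w
    · exact hh w
    · exact hf w
  exact this hy

end Span

variable [DecidableEq ι]

/-- Families satisfying the relations between Chevalley generators other than the Serre
relations. -/
structure IsChevalleyFamily (A : Matrix ι ι ℤ) (e h f : ι → L) : Prop where
  lie_h_h : ∀ i j, ⁅h i, h j⁆ = 0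
  lie_e_f : ∀ i j, ⁅e i, f j⁆ = if i = j then h i else 0
  lie_h_e : ∀ i j, ⁅h i, e j⁆ = (A i j : ℂ) • e j
  lie_h_f : ∀ i j, ⁅h i, f j⁆ = -((A i j : ℂ) • f j)

namespace IsChevalleyFamily

variable {A : Matrix ι ι ℤ} {e h f : ι → L}

/-- The Chevalley involution; it transfers each statement about the `e i` to the `f i`. -/
theorem swap (c : IsChevalleyFamily A e h f) : IsChevalleyFamily A f (-h) e where
  lie_h_h i j := by simp [c.lie_h_h]
  lie_e_f i j := by
    rw [← lie_skew, c.lie_e_f]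
    by_cases hij : i = j
    · simp [hij]
    · simp [hij, Ne.symm hij]
  lie_h_e i j := by simp [c.lie_h_f]
  lie_h_f i j := by simp [c.lie_h_e]

theorem lie_e_h (c : IsChevalleyFamily A e h f) (i j : ι) : ⁅e i, h j⁆ = -((A j i : ℂ) • e i) := by
  rw [← lie_skew, c.lie_h_e]

theorem lie_f_e (c : IsChevalleyFamily A e h f) (i j : ι) :
    ⁅f i, e j⁆ = if i = j then -h i else 0 := c.swap.lie_e_f i j

end IsChevalleyFamily

namespace IsChevalleyFamily

variable {A : Matrix ι ι ℤ} {e h f : ι → L}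

theorem lie_h_lieWord (c : IsChevalleyFamily A e h f) (i : ι) (w : List ι) :
    ⁅h i, lieWord e w⁆ = (((w.map (A i)).sum : ℤ) : ℂ) • lieWord e w := by
  induction w with
  | nil => simp [lieWord]
  | cons j w ih =>
    cases w with
    | nil => simp [lieWord, c.lie_h_e]
    | cons l w =>
      rw [lieWord, leibniz_lie, ih, c.lie_h_e, smul_lie, lie_smul, ← add_smul]
      simp

/-- By the Leibniz rule `f i` meets one letter at a time, turning it into `0` or `-h i`. The latter
acts on the rest of the word by a scalar. -/
theorem lie_f_lieWord_mem (c : IsChevalleyFamily A e h f) (i : ι) (w : List ι) :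
    ⁅f i, lieWord e w⁆ ∈
      Submodule.span ℂ (Set.range (lieWord e)) ⊔ Submodule.span ℂ (Set.range h) := by
  induction w with
  | nil => simp [lieWord]
  | cons j w ih =>
    cases w with
    | nil =>
      rw [lieWord, c.lie_f_e]
      split_ifs
      · exact Submodule.mem_sup_right (neg_mem (Submodule.subset_span ⟨i, rfl⟩))
      · exact zero_mem _
    | cons l w =>
      rw [lieWord, leibniz_lie]
      refine add_mem ?_ ?_
      · rw [c.lie_f_e]
        split_ifs
        · rw [neg_lie, c.lie_h_lieWord]
          exact Submodule.mem_sup_left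
            (neg_mem (Submodule.smul_mem _ _ (Submodule.subset_span ⟨_, rfl⟩)))
        · simp
      · obtain ⟨y, hy, z, hz, hyz⟩ := Submodule.mem_sup.1 ih
        rw [← hyz, lie_add]
        clear hyz
        refine Submodule.mem_sup_left (add_mem ?_ ?_)
        · induction hy using Submodule.span_induction with
          | mem x hx => obtain ⟨v, rfl⟩ := hx; exact lie_lieWord_mem e j v
          | zero => simp
          | add x y _ _ hx hy => rw [lie_add]; exact add_mem hx hy
          | smul a x _ hx => rw [lie_smul]; exact Submodule.smul_mem _ _ hx
        · induction hz using Submodule.span_induction with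
          | mem x hx =>
            obtain ⟨v, rfl⟩ := hx
            rw [c.lie_e_h]
            exact neg_mem (Submodule.smul_mem _ _ (Submodule.subset_span ⟨[j], rfl⟩))
          | zero => simp
          | add x y _ _ hx hy => rw [lie_add]; exact add_mem hx hy
          | smul a x _ hx => rw [lie_smul]; exact Submodule.smul_mem _ _ hx

theorem lie_e_mem_triangularSpan (c : IsChevalleyFamily A e h f) (i : ι) {y : L}
    (hy : y ∈ triangularSpan e h f) : ⁅e i, y⁆ ∈ triangularSpan e h f := by
  refine lie_mem_triangularSpan_of_forall (fun w => ?_) (fun j => ?_) (fun w => ?_) hy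
  · exact Submodule.mem_sup_left (Submodule.mem_sup_left (lie_lieWord_mem e i w))
  · rw [c.lie_e_h]
    exact neg_mem (Submodule.smul_mem _ _ (lieWord_mem_triangularSpan [i]))
  · rw [← triangularSpan_swap]
    exact Submodule.mem_sup_left (c.swap.lie_f_lieWord_mem i w)

theorem lie_f_mem_triangularSpan (c : IsChevalleyFamily A e h f) (i : ι) {y : L}
    (hy : y ∈ triangularSpan e h f) : ⁅f i, y⁆ ∈ triangularSpan e h f := by
  rw [← triangularSpan_swap] at hy ⊢
  exact c.swap.lie_e_mem_triangularSpan i hy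

theorem lie_h_mem_triangularSpan (c : IsChevalleyFamily A e h f) (i : ι) {y : L}
    (hy : y ∈ triangularSpan e h f) : ⁅h i, y⁆ ∈ triangularSpan e h f := by
  refine lie_mem_triangularSpan_of_forall (fun w => ?_) (fun j => ?_) (fun w => ?_) hy
  · rw [c.lie_h_lieWord]
    exact Submodule.smul_mem _ _ (lieWord_mem_triangularSpan w)
  · simp [c.lie_h_h]
  · have := c.swap.lie_h_lieWord i w
    rw [Pi.neg_apply, neg_lie, neg_eq_iff_eq_neg] at this
    rw [this]
    exact neg_mem (Submodule.smul_mem _ _ (lieWord_mem_triangularSpan' w))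

theorem triangularSpan_eq_top (c : IsChevalleyFamily A e h f)
    (hgen : LieSubalgebra.lieSpan ℂ L (Set.range e ∪ Set.range h ∪ Set.range f) = ⊤) :
    triangularSpan e h f = ⊤ := by
  -- The elements whose bracket preserves the span form a subalgebra containing the generators,
  -- hence everything. The span is then itself a subalgebra, and it contains the generators too.
  let K : LieSubalgebra ℂ L :=
    { carrier := {x | ∀ y ∈ triangularSpan e h f, ⁅x, y⁆ ∈ triangularSpan e h f}
      add_mem' := fun ha hb y hy => by rw [add_lie]; exact add_mem (ha y hy) (hb y hy)
      zero_mem' := fun y _ => by simp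
      smul_mem' := fun r x hx y hy => by rw [smul_lie]; exact Submodule.smul_mem _ _ (hx y hy)
      lie_mem' := fun {a b} ha hb y hy => by
        rw [lie_lie]; exact sub_mem (ha _ (hb _ hy)) (hb _ (ha _ hy)) }
  have hK : K = ⊤ := by
    rw [eq_top_iff, ← hgen, LieSubalgebra.lieSpan_le]
    rintro x ((⟨i, rfl⟩ | ⟨i, rfl⟩) | ⟨i, rfl⟩) y hy
    · exact c.lie_e_mem_triangularSpan i hy
    · exact c.lie_h_mem_triangularSpan i hy
    · exact c.lie_f_mem_triangularSpan i hy
  let U : LieSubalgebra ℂ L :=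
    { triangularSpan e h f with
      lie_mem' := fun {a b} _ hb => (hK ▸ LieSubalgebra.mem_top a : a ∈ K) b hb }
  have hU : U = ⊤ := by
    rw [eq_top_iff, ← hgen, LieSubalgebra.lieSpan_le]
    rintro x ((⟨i, rfl⟩ | ⟨i, rfl⟩) | ⟨i, rfl⟩)
    · exact lieWord_mem_triangularSpan [i]
    · exact h_mem_triangularSpan i
    · exact lieWord_mem_triangularSpan' [i]
  rw [eq_top_iff]
  intro x _
  exact (hU ▸ LieSubalgebra.mem_top x : x ∈ U)

/-- The weights of a Lie algebra generated by a Chevalley family are the weights of the nonzero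
iterated brackets, besides `0`. -/
theorem weight_eq (c : IsChevalleyFamily A e h f)
    (hgen : LieSubalgebra.lieSpan ℂ L (Set.range e ∪ Set.range h ∪ Set.range f) = ⊤)
    {x : L} (hx0 : x ≠ 0) {χ : ι → ℂ} (hx : ∀ i, ⁅h i, x⁆ = χ i • x) :
    χ = 0 ∨ (∃ w, lieWord e w ≠ 0 ∧ ∀ i, χ i = ((w.map (A i)).sum : ℤ)) ∨
      ∃ w, lieWord f w ≠ 0 ∧ ∀ i, χ i = -((w.map (A i)).sum : ℤ) := by
  by_contra hcon
  rw [not_or, not_or] at hcon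
  obtain ⟨h0, h1, h2⟩ := hcon
  let φ : ι → Module.End ℂ L := fun i => LieAlgebra.ad ℂ L (h i)
  -- Joint generalized eigenspaces of the commuting `ad (h i)` are independent. If `χ` were none of
  -- the listed weights, the eigenspaces for the other weights would already span `L`, leaving no
  -- room for `x`.
  have hind := Module.End.independent_iInf_maxGenEigenspace_of_forall_mapsTo φ fun i j μ => by
    refine Module.End.mapsTo_maxGenEigenspace_of_comm ?_ μ
    ext y
    have := leibniz_lie (h j) (h i) y
    rw [c.lie_h_h, zero_lie, zero_add] at this
    exact this
  let G : (ι → ℂ) → Submodule ℂ L := fun χ => ⨅ i, (φ i).maxGenEigenspace (χ i)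
  have hG : ∀ (χ : ι → ℂ) (y : L), (∀ i, ⁅h i, y⁆ = χ i • y) → y ∈ G χ := by
    intro χ y hy
    rw [Module.End.mem_iInf_maxGenEigenspace_iff]
    refine fun j => ⟨1, ?_⟩
    have : φ j y = χ j • y := hy j
    simp [this]
  have hle : ∀ (ψ : ι → ℂ), ψ ≠ χ → G ψ ≤ ⨆ (ψ) (_ : ψ ≠ χ), G ψ := fun ψ hψ =>
    le_iSup₂_of_le ψ hψ le_rfl
  have htop : (⨆ (ψ) (_ : ψ ≠ χ), G ψ) = ⊤ := by
    rw [eq_top_iff, ← c.triangularSpan_eq_top hgen]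
    refine sup_le (sup_le ?_ ?_) ?_
    all_goals
      rw [Submodule.span_le]
      rintro _ ⟨w, rfl⟩
    · by_cases hw : lieWord e w = 0
      · rw [hw]; exact zero_mem _
      · refine hle (fun i => ((w.map (A i)).sum : ℤ)) ?_ (hG _ _ fun i => c.lie_h_lieWord i w)
        rintro rfl
        exact h1 ⟨w, hw, fun i => rfl⟩
    · refine hle 0 (Ne.symm h0) (hG _ _ fun i => ?_)
      simp [c.lie_h_h]
    · by_cases hw : lieWord f w = 0
      · rw [hw]; exact zero_mem _
      · refine hle (fun i => -((w.map (A i)).sum : ℤ)) ?_ (hG _ _ fun i => ?_)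
        · rintro rfl
          exact h2 ⟨w, hw, fun i => rfl⟩
        · have := c.swap.lie_h_lieWord i w
          rw [Pi.neg_apply, neg_lie, neg_eq_iff_eq_neg] at this
          rw [this, neg_smul]
  have := hind χ
  change Disjoint (G χ) (⨆ (ψ) (_ : ψ ≠ χ), G ψ) at this
  rw [htop, disjoint_top] at this
  exact hx0 ((Submodule.mem_bot ℂ).1 (this ▸ hG χ x hx))

end IsChevalleyFamily

end Chevalley

/-! ### Serre elements are killed by the opposite generators -/

namespace IsChevalleyFamily

variable {ι L : Type*} [DecidableEq ι] [LieRing L] [LieAlgebra ℂ L]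
  {A : Matrix ι ι ℤ} {e h f : ι → L}

theorem lie_f_lie_e_e (c : IsChevalleyFamily A e h f) {i j : ι} (hij : A i j = A j i) (k : ι) :
    ⁅f k, ⁅e i, e j⁆⁆ =
      (A i j : ℂ) • ((if k = j then e i else 0) - (if k = i then e j else 0)) := by
  rw [leibniz_lie, c.lie_f_e, c.lie_f_e]
  by_cases hi : k = i
  · by_cases hj : k = j
    · subst hi hj
      simp [c.lie_h_e, c.lie_e_h]
    · subst hi
      simp [hj, c.lie_h_e]
  · by_cases hj : k = j
    · subst hj
      simp [hi, c.lie_e_h, hij]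
    · simp [hi, hj]

theorem lie_f_serre_of_eq_zero (c : IsChevalleyFamily A e h f) {i j : ι} (hij : A i j = 0)
    (hji : A j i = 0) (k : ι) : ⁅f k, ⁅e i, e j⁆⁆ = 0 := by
  rw [c.lie_f_lie_e_e (hij.trans hji.symm), hij]
  simp

/-- Only `k = i` needs cancellation: `-⁅h i, ⁅e i, e j⁆⁆` contributes `-(2 - 1)⁅e i, e j⁆`, and `⁅e
i, ⁅f i, ⁅e i, e j⁆⁆⁆` contributes `⁅e i, e j⁆`. -/
theorem lie_f_serre_of_eq_neg_one (c : IsChevalleyFamily A e h f) {i j : ι} (hii : A i i = 2)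
    (hij : A i j = -1) (hji : A j i = -1) (k : ι) : ⁅f k, ⁅e i, ⁅e i, e j⁆⁆⁆ = 0 := by
  rw [leibniz_lie, c.lie_f_lie_e_e (hij.trans hji.symm), c.lie_f_e, hij]
  have hne : i ≠ j := by rintro rfl; omega
  by_cases hi : k = i
  · subst hi
    rw [if_pos rfl, if_pos rfl, if_neg hne, neg_lie, leibniz_lie, c.lie_h_e, c.lie_h_e, hii, hij]
    simp only [smul_lie, lie_smul, lie_sub, lie_zero]
    push_cast
    module
  · by_cases hj : k = j
    · subst hj
      simp [hi]
    · simp [hi, hj]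

end IsChevalleyFamily

/-! ### A highest weight module on words, and its nondegenerate quotient -/

namespace WordModule

variable {ι : Type*} [DecidableEq ι] (A : Matrix ι ι ℤ)

/-- The lowering operator that prepends a letter. -/
def fOp (i : ι) : Module.End ℂ (List ι →₀ ℂ) :=
  Finsupp.linearCombination ℂ fun w => Finsupp.single (i :: w) 1

/-- The weight of a word; the empty word has weight `1` for each diagonal operator. -/
def wordWeight (i : ι) (w : List ι) : ℂ := 1 - ((w.map (A i)).sum : ℤ)

omit [DecidableEq ι] in
theorem wordWeight_cons (i j : ι) (w : List ι) :
    wordWeight A i (j :: w) = wordWeight A i w - A i j := by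
  simp [wordWeight]
  ring

omit [DecidableEq ι] in
theorem wordWeight_nil (i : ι) : wordWeight A i [] = 1 := by simp [wordWeight]

/-- The diagonal operators. -/
def hOp (i : ι) : Module.End ℂ (List ι →₀ ℂ) :=
  Finsupp.linearCombination ℂ fun w => wordWeight A i w • Finsupp.single w 1

/-- The values of the raising operators on words. -/
def eWord (i : ι) : List ι → (List ι →₀ ℂ)
  | [] => 0
  | j :: w => fOp j (eWord i w) + if i = j then hOp A i (Finsupp.single w 1) else 0

/-- The raising operators. -/
def eOp (i : ι) : Module.End ℂ (List ι →₀ ℂ) :=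
  Finsupp.linearCombination ℂ (eWord A i)

/-- The coefficient of the empty word. -/
def vac : (List ι →₀ ℂ) →ₗ[ℂ] ℂ := Finsupp.lapply []

omit [DecidableEq ι] in
@[simp] theorem fOp_single (i : ι) (w : List ι) :
    fOp i (Finsupp.single w 1) = Finsupp.single (i :: w) 1 := by simp [fOp]

omit [DecidableEq ι] in
@[simp] theorem hOp_single (i : ι) (w : List ι) : hOp A i (Finsupp.single w 1) =
    wordWeight A i w • Finsupp.single w 1 := by simp [hOp]

@[simp] theorem eOp_single (i : ι) (w : List ι) : eOp A i (Finsupp.single w 1) = eWord A i w := by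
  simp [eOp]

omit [DecidableEq ι] in
theorem hOp_fOp (i j : ι) (x : List ι →₀ ℂ) :
    hOp A i (fOp j x) = fOp j (hOp A i x) - (A i j : ℂ) • fOp j x := by
  have : hOp A i * fOp j = fOp j * hOp A i - (A i j : ℂ) • fOp j := by
    refine Finsupp.lhom_ext' fun w => LinearMap.ext_ring ?_
    simp [wordWeight_cons, sub_smul, -Finsupp.smul_single]
  exact LinearMap.congr_fun this x

theorem eOp_fOp (i j : ι) (x : List ι →₀ ℂ) :
    eOp A i (fOp j x) = fOp j (eOp A i x) + if i = j then hOp A i x else 0 := by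
  have : eOp A i * fOp j = fOp j * eOp A i + if i = j then hOp A i else 0 := by
    refine Finsupp.lhom_ext' fun w => LinearMap.ext_ring ?_
    split_ifs with hij <;> simp [eWord, hij]
  have := LinearMap.congr_fun this x
  split_ifs at this ⊢ <;> simpa using this

omit [DecidableEq ι] in
theorem hOp_hOp (i j : ι) (x : List ι →₀ ℂ) : hOp A i (hOp A j x) = hOp A j (hOp A i x) := by
  have : hOp A i * hOp A j = hOp A j * hOp A i := by
    refine Finsupp.lhom_ext' fun w => LinearMap.ext_ring ?_
    simp [smul_smul, mul_comm, -Finsupp.smul_single]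
  exact LinearMap.congr_fun this x

theorem hOp_eOp (i j : ι) (x : List ι →₀ ℂ) :
    hOp A i (eOp A j x) = eOp A j (hOp A i x) + (A i j : ℂ) • eOp A j x := by
  have hw : ∀ w : List ι, hOp A i (eWord A j w) =
      (wordWeight A i w + A i j) • eWord A j w := by
    intro w
    induction w with
    | nil => simp [eWord]
    | cons l w ih =>
      rw [eWord, map_add, hOp_fOp, ih, map_smul, ← sub_smul, smul_add]
      congr 1
      · rw [wordWeight_cons]
        congr 1
        ring
      · split_ifs with hjl
        · subst hjl
          rw [hOp_hOp]
          simp [smul_smul, wordWeight_cons, -Finsupp.smul_single]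
        · simp
  have : hOp A i * eOp A j = eOp A j * hOp A i + (A i j : ℂ) • eOp A j := by
    refine Finsupp.lhom_ext' fun w => LinearMap.ext_ring ?_
    simp [hw, add_smul, -Finsupp.smul_single]
  exact LinearMap.congr_fun this x

omit [DecidableEq ι] in
theorem vac_fOp (i : ι) (x : List ι →₀ ℂ) : vac (fOp i x) = 0 := by
  have : vac ∘ₗ fOp i = 0 := by
    refine Finsupp.lhom_ext' fun w => LinearMap.ext_ring ?_
    simp [vac]
  exact LinearMap.congr_fun this x

omit [DecidableEq ι] in
theorem vac_hOp (i : ι) (x : List ι →₀ ℂ) : vac (hOp A i x) = vac x := by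
  have : vac ∘ₗ hOp A i = vac := by
    refine Finsupp.lhom_ext' fun w => LinearMap.ext_ring ?_
    cases w <;> simp [vac, wordWeight_nil]
  exact LinearMap.congr_fun this x

/-- The vectors from which raising operators never produce a multiple of the empty word. -/
def radical : Submodule ℂ (List ι →₀ ℂ) :=
  ⨅ w : List ι, LinearMap.ker (vac ∘ₗ ((w.map (eOp A)).prod : Module.End ℂ (List ι →₀ ℂ)))

theorem mem_radical {x : List ι →₀ ℂ} :
    x ∈ radical A ↔ ∀ w : List ι, vac ((w.map (eOp A)).prod x) = 0 := by
  simp [radical]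

theorem eOp_mem_radical (i : ι) {x : List ι →₀ ℂ} (hx : x ∈ radical A) :
    eOp A i x ∈ radical A := by
  rw [mem_radical] at hx ⊢
  intro w
  simpa using hx (w ++ [i])

theorem vac_eq_zero_of_mem_radical {x : List ι →₀ ℂ} (hx : x ∈ radical A) : vac x = 0 :=
  (mem_radical A).1 hx []

theorem hOp_mem_radical (i : ι) {x : List ι →₀ ℂ} (hx : x ∈ radical A) :
    hOp A i x ∈ radical A := by
  rw [mem_radical]
  intro w
  induction w using List.reverseRecOn generalizing x with
  | nil => simpa [vac_hOp] using vac_eq_zero_of_mem_radical A hx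
  | append_singleton w j ih =>
    have h1 := eOp_mem_radical A j hx
    have h2 := hOp_eOp A i j x
    rw [← sub_eq_iff_eq_add] at h2
    simp [← h2, ih h1, (mem_radical A).1 h1 w]

theorem fOp_mem_radical (i : ι) {x : List ι →₀ ℂ} (hx : x ∈ radical A) :
    fOp i x ∈ radical A := by
  rw [mem_radical]
  intro w
  -- The last letter acts first, so it is the one to be commuted past `fOp i`.
  induction w using List.reverseRecOn generalizing x with
  | nil => simp [vac_fOp]
  | append_singleton w j ih =>
    have h1 := ih (eOp_mem_radical A j hx)
    have h2 := (mem_radical A).1 (hOp_mem_radical A j hx) w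
    simp only [List.map_append, List.map_cons, List.map_nil, List.prod_append, List.prod_cons,
      List.prod_nil, mul_one, Module.End.mul_apply, eOp_fOp, map_add, h1, zero_add]
    split_ifs
    · exact h2
    · simp

/-- The quotient by the radical. -/
abbrev Quot : Type _ := (List ι →₀ ℂ) ⧸ radical A

/-- The raising operators on the quotient. -/
def eQuot (i : ι) : Module.End ℂ (Quot A) :=
  (radical A).mapQ (radical A) (eOp A i) fun _ => eOp_mem_radical A i

/-- The diagonal operators on the quotient. -/
def hQuot (i : ι) : Module.End ℂ (Quot A) :=
  (radical A).mapQ (radical A) (hOp A i) fun _ => hOp_mem_radical A i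

/-- The lowering operators on the quotient. -/
def fQuot (i : ι) : Module.End ℂ (Quot A) :=
  (radical A).mapQ (radical A) (fOp i) fun _ => fOp_mem_radical A i

theorem eQuot_mk (i : ι) (x : List ι →₀ ℂ) :
    eQuot A i (Submodule.Quotient.mk x) = Submodule.Quotient.mk (eOp A i x) := rfl

theorem hQuot_mk (i : ι) (x : List ι →₀ ℂ) :
    hQuot A i (Submodule.Quotient.mk x) = Submodule.Quotient.mk (hOp A i x) := rfl

theorem fQuot_mk (i : ι) (x : List ι →₀ ℂ) :
    fQuot A i (Submodule.Quotient.mk x) = Submodule.Quotient.mk (fOp i x) := rfl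

/-- The coefficient of the empty word on the quotient. -/
def vacQuot : Quot A →ₗ[ℂ] ℂ :=
  (radical A).liftQ vac fun _ => vac_eq_zero_of_mem_radical A

theorem vacQuot_mk (x : List ι →₀ ℂ) :
    vacQuot A (Submodule.Quotient.mk x) = vac x := rfl

theorem isChevalleyFamily : IsChevalleyFamily A (eQuot A) (hQuot A) (fQuot A) := by
  constructor <;> intro i j <;> refine LinearMap.ext fun x => ?_ <;>
    obtain ⟨x, rfl⟩ := Submodule.Quotient.mk_surjective _ x <;>
    simp only [Ring.lie_def, LinearMap.sub_apply, Module.End.mul_apply, eQuot_mk, hQuot_mk,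
      fQuot_mk, LinearMap.neg_apply, LinearMap.smul_apply, LinearMap.zero_apply,
      ← Submodule.Quotient.mk_sub, ← Submodule.Quotient.mk_smul, ← Submodule.Quotient.mk_neg]
  · rw [hOp_hOp, sub_self]; rfl
  · rw [eOp_fOp, add_sub_cancel_left]
    split_ifs <;> rfl
  · rw [hOp_eOp, add_sub_cancel_left]
  · rw [hOp_fOp, sub_sub_cancel_left]

theorem vacQuot_fQuot (i : ι) (x : Quot A) : vacQuot A (fQuot A i x) = 0 := by
  obtain ⟨x, rfl⟩ := Submodule.Quotient.mk_surjective _ x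
  exact vac_fOp i x

theorem eQuot_vacuum (i : ι) :
    eQuot A i (Submodule.Quotient.mk (Finsupp.single [] 1)) = 0 := by
  rw [eQuot_mk, eOp_single, eWord, Submodule.Quotient.mk_zero]

/-- The lowering operators generate the module from the empty word. -/
theorem eq_zero_of_lie_fQuot {X : Module.End ℂ (Quot A)} (hX : ∀ k, ⁅fQuot A k, X⁆ = 0)
    (h0 : X (Submodule.Quotient.mk (Finsupp.single [] 1)) = 0) : X = 0 := by
  refine LinearMap.ext fun x => ?_
  obtain ⟨x, rfl⟩ := Submodule.Quotient.mk_surjective _ x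
  have : X ∘ₗ (radical A).mkQ = 0 := by
    refine Finsupp.lhom_ext' fun w => LinearMap.ext_ring ?_
    simp only [LinearMap.comp_apply, Finsupp.lsingle_apply, Submodule.mkQ_apply,
      LinearMap.zero_apply]
    induction w with
    | nil => exact h0
    | cons i w ih =>
      have := LinearMap.congr_fun (hX i) (Submodule.Quotient.mk (Finsupp.single w 1))
      rw [Ring.lie_def, LinearMap.sub_apply, Module.End.mul_apply, Module.End.mul_apply, ih,
        fQuot_mk, fOp_single] at this
      simpa using this
  exact LinearMap.congr_fun this x

/-- Raising operators move through `X`, so no vector in its image ever reaches the empty word; the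
image vanishes because the radical was divided out. -/
theorem eq_zero_of_lie_eQuot {X : Module.End ℂ (Quot A)} (hX : ∀ k, ⁅eQuot A k, X⁆ = 0)
    (h0 : ∀ x, vacQuot A (X x) = 0) : X = 0 := by
  refine LinearMap.ext fun x => ?_
  obtain ⟨y, hy⟩ := Submodule.Quotient.mk_surjective _ (X x)
  rw [← hy, LinearMap.zero_apply, Submodule.Quotient.mk_eq_zero, mem_radical]
  intro w
  induction w using List.reverseRecOn generalizing x y with
  | nil =>
    have := h0 x
    rwa [← hy, vacQuot_mk] at this
  | append_singleton w i ih =>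
    have := LinearMap.congr_fun (hX i) x
    rw [Ring.lie_def, LinearMap.sub_apply, Module.End.mul_apply, Module.End.mul_apply, ← hy,
      eQuot_mk, LinearMap.zero_apply, sub_eq_zero] at this
    simpa using ih _ _ this

/-- The condition on the Cartan matrix of a simply laced Dynkin diagram. -/
def IsSimplyLaced (A : Matrix ι ι ℤ) : Prop :=
  ∀ i j, A i i = 2 ∧ (i = j ∨ A i j = 0 ∧ A j i = 0 ∨ A i j = -1 ∧ A j i = -1)

variable {A}

theorem serre_eQuot (hA : IsSimplyLaced A) (i j : ι) :
    (LieAlgebra.ad ℂ (Module.End ℂ (Quot A)) (eQuot A i) ^ (-A i j).toNat)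
      ⁅eQuot A i, eQuot A j⁆ = 0 := by
  obtain ⟨hii, rfl | ⟨hij, hji⟩ | ⟨hij, hji⟩⟩ := hA i j
  · simp
  · rw [hij]
    refine eq_zero_of_lie_fQuot A
      (fun k => (isChevalleyFamily A).lie_f_serre_of_eq_zero hij hji k) ?_
    simp [Ring.lie_def, eQuot_vacuum]
  · rw [hij]
    refine eq_zero_of_lie_fQuot A
      (fun k => (isChevalleyFamily A).lie_f_serre_of_eq_neg_one hii hij hji k) ?_
    simp [Ring.lie_def, eQuot_vacuum]

theorem serre_fQuot (hA : IsSimplyLaced A) (i j : ι) :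
    (LieAlgebra.ad ℂ (Module.End ℂ (Quot A)) (fQuot A i) ^ (-A i j).toNat)
      ⁅fQuot A i, fQuot A j⁆ = 0 := by
  obtain ⟨hii, rfl | ⟨hij, hji⟩ | ⟨hij, hji⟩⟩ := hA i j
  · simp
  · rw [hij]
    refine eq_zero_of_lie_eQuot A
      (fun k => (isChevalleyFamily A).swap.lie_f_serre_of_eq_zero hij hji k) ?_
    simp [Ring.lie_def, vacQuot_fQuot]
  · rw [hij]
    refine eq_zero_of_lie_eQuot A
      (fun k => (isChevalleyFamily A).swap.lie_f_serre_of_eq_neg_one hii hij hji k) ?_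
    simp [Ring.lie_def, vacQuot_fQuot]

variable (A)

/-- The representation of the free Lie algebra on the quotient. -/
def rep : FreeLieAlgebra ℂ (CartanMatrix.Generators ι) →ₗ⁅ℂ⁆ Module.End ℂ (Quot A) :=
  FreeLieAlgebra.lift ℂ fun
    | .H i => hQuot A i
    | .E i => eQuot A i
    | .F i => fQuot A i

theorem rep_H (i : ι) : rep A (FreeLieAlgebra.of ℂ (.H i)) = hQuot A i := by simp [rep]

theorem rep_E (i : ι) : rep A (FreeLieAlgebra.of ℂ (.E i)) = eQuot A i := by simp [rep]

theorem rep_F (i : ι) : rep A (FreeLieAlgebra.of ℂ (.F i)) = fQuot A i := by simp [rep]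

theorem map_ad_pow {L L' : Type*} [LieRing L] [LieAlgebra ℂ L] [LieRing L'] [LieAlgebra ℂ L']
    (φ : L →ₗ⁅ℂ⁆ L') (x y : L) (n : ℕ) :
    φ ((LieAlgebra.ad ℂ L x ^ n) y) = (LieAlgebra.ad ℂ L' (φ x) ^ n) (φ y) := by
  induction n with
  | zero => simp
  | succ n ih => simp [pow_succ', ih]

variable {A}

theorem toIdeal_le_ker_rep (hA : IsSimplyLaced A) :
    CartanMatrix.Relations.toIdeal ℂ A ≤ (rep A).ker := by
  have c := isChevalleyFamily A
  rw [CartanMatrix.Relations.toIdeal, LieSubmodule.lieSpan_le]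
  rintro _ (((((⟨⟨i, j⟩, rfl⟩ | ⟨⟨i, j⟩, rfl⟩) | ⟨⟨i, j⟩, rfl⟩) | ⟨⟨i, j⟩, rfl⟩) | ⟨⟨i, j⟩, rfl⟩) |
    ⟨⟨i, j⟩, rfl⟩) <;> rw [SetLike.mem_coe, LieHom.mem_ker]
  · simp [CartanMatrix.Relations.HH, rep_H, c.lie_h_h]
  · by_cases hij : i = j
    · simp [CartanMatrix.Relations.EF, hij, rep_H, rep_E, rep_F, c.lie_e_f]
    · simp [CartanMatrix.Relations.EF, hij, rep_E, rep_F, c.lie_e_f]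
  · simp [CartanMatrix.Relations.HE, rep_H, rep_E, c.lie_h_e, ← Int.cast_smul_eq_zsmul ℂ]
  · simp [CartanMatrix.Relations.HF, rep_H, rep_F, c.lie_h_f, ← Int.cast_smul_eq_zsmul ℂ]
  · simpa [CartanMatrix.Relations.adE, map_ad_pow, rep_E] using serre_eQuot hA i j
  · simpa [CartanMatrix.Relations.adF, map_ad_pow, rep_F] using serre_fQuot hA i j

/-- `e i` maps the word `[i]` to the empty word with coefficient its weight `1`, and the empty word
is not in the radical. -/
theorem eQuot_ne_zero (i : ι) : eQuot A i ≠ 0 := by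
  intro h0
  have := LinearMap.congr_fun h0 (Submodule.Quotient.mk (Finsupp.single [i] 1))
  rw [eQuot_mk, eOp_single, LinearMap.zero_apply, Submodule.Quotient.mk_eq_zero] at this
  have := vac_eq_zero_of_mem_radical A this
  simp [eWord, vac, wordWeight_nil] at this

theorem of_E_notMem_toIdeal (hA : IsSimplyLaced A) (i : ι) :
    FreeLieAlgebra.of ℂ (.E i) ∉ CartanMatrix.Relations.toIdeal ℂ A := fun h =>
  eQuot_ne_zero i (by rw [← rep_E, ← LieHom.mem_ker]; exact toIdeal_le_ker_rep hA h)

end WordModule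

/-! ### Generators and relations in `E₁₀` -/

/-- The projection from the free Lie algebra. -/
def proj : FreeLieAlgebra ℂ (CartanMatrix.Generators (Fin 10)) →ₗ⁅ℂ⁆ Algebra where
  toFun x := LieSubmodule.Quotient.mk (N := CartanMatrix.Relations.toIdeal ℂ cartanMatrix) x
  map_add' _ _ := rfl
  map_smul' _ _ := rfl
  map_lie' := rfl

theorem proj_eq_zero {x : FreeLieAlgebra ℂ (CartanMatrix.Generators (Fin 10))} :
    proj x = 0 ↔ x ∈ CartanMatrix.Relations.toIdeal ℂ cartanMatrix :=
  LieSubmodule.Quotient.mk_eq_zero' (N := CartanMatrix.Relations.toIdeal ℂ cartanMatrix)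

theorem proj_eq_zero_of_mem {x : FreeLieAlgebra ℂ (CartanMatrix.Generators (Fin 10))}
    (hx : x ∈ CartanMatrix.Relations.toSet ℂ cartanMatrix) : proj x = 0 :=
  proj_eq_zero.2 (LieSubmodule.subset_lieSpan hx)

/-- The generator `E i` of `E₁₀`. -/
def E (i : Fin 10) : Algebra := proj (FreeLieAlgebra.of ℂ (.E i))

/-- The generator `F i` of `E₁₀`. -/
def F (i : Fin 10) : Algebra := proj (FreeLieAlgebra.of ℂ (.F i))

theorem proj_H (i : Fin 10) : proj (FreeLieAlgebra.of ℂ (.H i)) = H i := rfl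

theorem proj_E (i : Fin 10) : proj (FreeLieAlgebra.of ℂ (.E i)) = E i := rfl

theorem proj_F (i : Fin 10) : proj (FreeLieAlgebra.of ℂ (.F i)) = F i := rfl

theorem isSimplyLaced_cartanMatrix : WordModule.IsSimplyLaced cartanMatrix := by
  have h1 : ∀ i, cartanMatrix i i = 2 := by decide
  have h2 : ∀ i j, i = j ∨ cartanMatrix i j = 0 ∧ cartanMatrix j i = 0 ∨
      cartanMatrix i j = -1 ∧ cartanMatrix j i = -1 := by
    intro i
    fin_cases i <;> decide
  exact fun i j => ⟨h1 i, h2 i j⟩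

theorem E_ne_zero (i : Fin 10) : E i ≠ 0 := fun h =>
  WordModule.of_E_notMem_toIdeal isSimplyLaced_cartanMatrix i (proj_eq_zero.1 h)

theorem isChevalleyFamily : IsChevalleyFamily cartanMatrix E H F where
  lie_h_h i j := by
    have := proj_eq_zero_of_mem (x := CartanMatrix.Relations.HH ℂ (i, j))
      (by simp [CartanMatrix.Relations.toSet])
    simpa [CartanMatrix.Relations.HH, proj_H] using this
  lie_e_f i j := by
    have := proj_eq_zero_of_mem (x := CartanMatrix.Relations.EF ℂ (i, j))
      (by simp [CartanMatrix.Relations.toSet])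
    by_cases hij : i = j
    · subst hij
      simpa [CartanMatrix.Relations.EF, proj_H, proj_E, proj_F, sub_eq_zero] using this
    · simpa [CartanMatrix.Relations.EF, hij, proj_E, proj_F] using this
  lie_h_e i j := by
    have := proj_eq_zero_of_mem (x := CartanMatrix.Relations.HE ℂ cartanMatrix (i, j))
      (by simp [CartanMatrix.Relations.toSet])
    simpa [CartanMatrix.Relations.HE, proj_H, proj_E, sub_eq_zero, ← Int.cast_smul_eq_zsmul ℂ]
      using this
  lie_h_f i j := by
    have := proj_eq_zero_of_mem (x := CartanMatrix.Relations.HF ℂ cartanMatrix (i, j))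
      (by simp [CartanMatrix.Relations.toSet])
    simpa [CartanMatrix.Relations.HF, proj_H, proj_F, add_eq_zero_iff_eq_neg,
      ← Int.cast_smul_eq_zsmul ℂ] using this

theorem serre_E (i j : Fin 10) :
    (LieAlgebra.ad ℂ Algebra (E i) ^ (-cartanMatrix i j).toNat) ⁅E i, E j⁆ = 0 := by
  have := proj_eq_zero_of_mem (x := CartanMatrix.Relations.adE ℂ cartanMatrix (i, j))
    (by simp [CartanMatrix.Relations.toSet])
  simpa [CartanMatrix.Relations.adE, WordModule.map_ad_pow, proj_E] using this

theorem serre_F (i j : Fin 10) :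
    (LieAlgebra.ad ℂ Algebra (F i) ^ (-cartanMatrix i j).toNat) ⁅F i, F j⁆ = 0 := by
  have := proj_eq_zero_of_mem (x := CartanMatrix.Relations.adF ℂ cartanMatrix (i, j))
    (by simp [CartanMatrix.Relations.toSet])
  simpa [CartanMatrix.Relations.adF, WordModule.map_ad_pow, proj_F] using this

theorem lieSpan_generators :
    LieSubalgebra.lieSpan ℂ Algebra (Set.range E ∪ Set.range H ∪ Set.range F) = ⊤ := by
  set S := LieSubalgebra.lieSpan ℂ Algebra (Set.range E ∪ Set.range H ∪ Set.range F)
  have hS : ∀ g, proj (FreeLieAlgebra.of ℂ g) ∈ S := by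
    intro g
    apply LieSubalgebra.subset_lieSpan
    cases g with
    | H i => exact Or.inl (Or.inr ⟨i, rfl⟩)
    | E i => exact Or.inl (Or.inl ⟨i, rfl⟩)
    | F i => exact Or.inr ⟨i, rfl⟩
  let φ : FreeLieAlgebra ℂ (CartanMatrix.Generators (Fin 10)) →ₗ⁅ℂ⁆ S :=
    FreeLieAlgebra.lift ℂ fun g => ⟨_, hS g⟩
  have hφ : S.incl.comp φ = proj := by
    ext g
    simp [φ]
  rw [eq_top_iff]
  intro x _
  obtain ⟨y, hy⟩ := LieSubmodule.Quotient.surjective_mk'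
    (CartanMatrix.Relations.toIdeal ℂ cartanMatrix) x
  have : proj y = x := hy
  rw [← this, ← hφ]
  exact (φ y).2

/-! ### Local nilpotency and strings in the adjoint representation -/

namespace IsChevalleyFamily

variable {ι L : Type*} [DecidableEq ι] [LieRing L] [LieAlgebra ℂ L]
  {A : Matrix ι ι ℤ} {e h f : ι → L}

/-- The elements killed by a power of `ad (e i)` form the Engel subalgebra, so it suffices to check
generators; the Serre relations handle the `e j`. -/
theorem exists_ad_pow_eq_zero (c : IsChevalleyFamily A e h f)
    (hgen : LieSubalgebra.lieSpan ℂ L (Set.range e ∪ Set.range h ∪ Set.range f) = ⊤) (i : ι)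
    (hs : ∀ j, (LieAlgebra.ad ℂ L (e i) ^ (-A i j).toNat) ⁅e i, e j⁆ = 0) (x : L) :
    ∃ n, (LieAlgebra.ad ℂ L (e i) ^ n) x = 0 := by
  rw [← LieSubalgebra.mem_engel_iff]
  suffices LieSubalgebra.engel ℂ (e i) = ⊤ from this ▸ LieSubalgebra.mem_top x
  rw [eq_top_iff, ← hgen, LieSubalgebra.lieSpan_le]
  rintro x ((⟨j, rfl⟩ | ⟨j, rfl⟩) | ⟨j, rfl⟩) <;>
    rw [SetLike.mem_coe, LieSubalgebra.mem_engel_iff]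
  · exact ⟨(-A i j).toNat + 1, by rw [pow_succ, Module.End.mul_apply]; exact hs j⟩
  · exact ⟨2, by simp [pow_two, c.lie_e_h]⟩
  · refine ⟨3, ?_⟩
    by_cases hij : i = j
    · subst hij
      simp [pow_succ, c.lie_e_h, c.lie_e_f]
    · simp [pow_succ, c.lie_e_f, hij]

/-- A string of weights: if a nonzero vector has weight `m` for `h i`, then `f i` can be applied
to it `m` times. -/
theorem ad_pow_ne_zero (c : IsChevalleyFamily A e h f)
    (hgen : LieSubalgebra.lieSpan ℂ L (Set.range e ∪ Set.range h ∪ Set.range f) = ⊤) (i : ι)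
    (hii : A i i = 2) (hs : ∀ j, (LieAlgebra.ad ℂ L (e i) ^ (-A i j).toNat) ⁅e i, e j⁆ = 0)
    {x : L} (hx0 : x ≠ 0) {m n : ℕ} (hx : ⁅h i, x⁆ = (m : ℂ) • x) (hn : n ≤ m) :
    (LieAlgebra.ad ℂ L (f i) ^ n) x ≠ 0 := by
  refine pow_lower_ne_zero (e := LieAlgebra.ad ℂ L (e i)) (h := LieAlgebra.ad ℂ L (h i))
    (fun y => ?_) (fun y => ?_) (fun y => ?_) hx hx0 (c.exists_ad_pow_eq_zero hgen i hs x) hn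
  · simp only [LieAlgebra.ad_apply]
    rw [leibniz_lie, c.lie_e_f, if_pos rfl, add_comm]
  · simp only [LieAlgebra.ad_apply]
    rw [leibniz_lie, c.lie_h_e, hii, smul_lie, add_comm]
    simp
  · simp only [LieAlgebra.ad_apply]
    rw [leibniz_lie, c.lie_h_f, hii, neg_lie, smul_lie, add_comm, sub_eq_add_neg]
    simp

theorem lie_h_ad_pow (c : IsChevalleyFamily A e h f) (i j : ι) {x : L} {μ : ℂ}
    (hx : ⁅h j, x⁆ = μ • x) (n : ℕ) :
    ⁅h j, (LieAlgebra.ad ℂ L (f i) ^ n) x⁆ =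
      (μ - n * A j i) • (LieAlgebra.ad ℂ L (f i) ^ n) x := by
  induction n with
  | zero => simp [hx]
  | succ n ih =>
    rw [pow_succ', Module.End.mul_apply, LieAlgebra.ad_apply, leibniz_lie, ih, c.lie_h_f, neg_lie,
      smul_lie, lie_smul]
    push_cast
    module

end IsChevalleyFamily

/-! ### Root strings in `𝔥*` -/

theorem mem_rootSpace {a : Dual} {x : Algebra} :
    x ∈ rootSpace a ↔ ∀ i, ⁅H i, x⁆ = (coroot i a : ℂ) • x := by
  constructor
  · intro hx i
    have := hx (Pi.single i 1)
    simpa [Pi.single_apply, Finset.sum_ite_eq'] using this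
  · intro hx c
    simp only [sum_lie, smul_lie, hx, smul_smul, ← Finset.sum_smul]
    push_cast
    rfl

theorem exists_of_isRoot {a : Dual} (ha : IsRoot a) :
    ∃ x : Algebra, x ≠ 0 ∧ ∀ i, ⁅H i, x⁆ = (coroot i a : ℂ) • x := by
  obtain ⟨x, hx, hx0⟩ := Submodule.exists_mem_ne_zero_of_ne_bot ha.2
  exact ⟨x, hx0, mem_rootSpace.1 hx⟩

theorem isRoot_of_exists {a : Dual} (ha : a ≠ 0) {x : Algebra} (hx0 : x ≠ 0)
    (hx : ∀ i, ⁅H i, x⁆ = (coroot i a : ℂ) • x) : IsRoot a :=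
  ⟨ha, fun h => hx0 ((Submodule.mem_bot ℂ).1 (h ▸ mem_rootSpace.2 hx))⟩

theorem cartanMatrix_self (i : Fin 10) : cartanMatrix i i = 2 :=
  (isSimplyLaced_cartanMatrix i i).1

/-- Applying `ad (F i)` to a root vector `n ≤ m` times keeps it nonzero. The case `n = m` is the
reflection. -/
theorem isRoot_sub_of_coroot_eq {a : Dual} (ha : IsRoot a) (i : Fin 10) {m n : ℕ}
    (hm : coroot i a = m) (hn : n ≤ m) (h0 : a - (n : ℝ) • simpleRoot i ≠ 0) :
    IsRoot (a - (n : ℝ) • simpleRoot i) := by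
  obtain ⟨x, hx0, hx⟩ := exists_of_isRoot ha
  refine isRoot_of_exists h0 (isChevalleyFamily.ad_pow_ne_zero lieSpan_generators i
    (cartanMatrix_self i) (serre_E i) hx0 (by rw [hx i, hm]; simp) hn) fun j => ?_
  rw [isChevalleyFamily.lie_h_ad_pow i j (hx j), map_sub, map_smul, coroot_simpleRoot]
  simp

theorem isRoot_add_of_coroot_eq {a : Dual} (ha : IsRoot a) (i : Fin 10) {m n : ℕ}
    (hm : coroot i a = -m) (hn : n ≤ m) (h0 : a + (n : ℝ) • simpleRoot i ≠ 0) :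
    IsRoot (a + (n : ℝ) • simpleRoot i) := by
  obtain ⟨x, hx0, hx⟩ := exists_of_isRoot ha
  have hgen : LieSubalgebra.lieSpan ℂ Algebra (Set.range F ∪ Set.range (-H) ∪ Set.range E) = ⊤ := by
    rw [eq_top_iff, ← lieSpan_generators, LieSubalgebra.lieSpan_le]
    rintro x ((⟨j, rfl⟩ | ⟨j, rfl⟩) | ⟨j, rfl⟩)
    · exact LieSubalgebra.subset_lieSpan (Or.inr ⟨j, rfl⟩)
    · rw [← neg_neg (H j)]
      exact neg_mem (LieSubalgebra.subset_lieSpan (Or.inl (Or.inr ⟨j, rfl⟩)))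
    · exact LieSubalgebra.subset_lieSpan (Or.inl (Or.inl ⟨j, rfl⟩))
  refine isRoot_of_exists h0 (isChevalleyFamily.swap.ad_pow_ne_zero hgen i
    (cartanMatrix_self i) (serre_F i) hx0 (m := m) (by simp [hx i, hm]) hn) fun j => ?_
  have := isChevalleyFamily.swap.lie_h_ad_pow i j (x := x) (μ := -(coroot j a : ℂ))
    (by simp [hx j]) n
  rw [Pi.neg_apply, neg_lie, neg_eq_iff_eq_neg, ← neg_smul] at this
  rw [this, map_add, map_smul, coroot_simpleRoot]
  simp
  ring_nf

theorem isRoot_simpleRoot (i : Fin 10) (h0 : simpleRoot i ≠ 0) : IsRoot (simpleRoot i) :=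
  isRoot_of_exists h0 (E_ne_zero i) fun j => by
    rw [isChevalleyFamily.lie_h_e, coroot_simpleRoot]
    simp

/-! ### Coordinates with respect to the simple roots -/

theorem simpleRoot_ne_zero (i : Fin 10) : simpleRoot i ≠ 0 := fun h => by
  simpa [h] using coroot_simpleRoot_self i

theorem eq_zero_of_coroot_eq_zero {a : Dual} (h : ∀ i, coroot i a = 0) : a = 0 := by
  simp only [coroot, form, simpleRoot, simpleRootInt, LinearMap.coe_mk, AddHom.coe_mk] at h
  simp only [Fin.forall_fin_succ, Fin.sum_univ_succ] at h
  simp at h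
  ext i
  fin_cases i <;> simp <;> linarith

/-- Three times the inverse of the matrix of the simple roots. -/
def coeffMatrix : Fin 10 → Fin 10 → ℤ :=
  ![![3,  0,  0,  0,  0,  0,  0,  0,  0,  0],
    ![3,  3,  0,  0,  0,  0,  0,  0,  0,  0],
    ![3,  3,  3,  0,  0,  0,  0,  0,  0,  0],
    ![3,  3,  3,  3,  0,  0,  0,  0,  0,  0],
    ![3,  3,  3,  3,  3,  0,  0,  0,  0,  0],
    ![3,  3,  3,  3,  3,  3,  0,  0,  0,  0],
    ![3,  3,  3,  3,  3,  3,  3,  0,  0,  0],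
    ![2,  2,  2,  2,  2,  2,  2,  2, -1, -1],
    ![1,  1,  1,  1,  1,  1,  1,  1,  1, -2],
    ![1,  1,  1,  1,  1,  1,  1,  1,  1,  1]]

/-- The coefficients of a linear combination of simple roots. -/
def coeff (m : Fin 10) : Dual →ₗ[ℝ] ℝ :=
  (1 / 3 : ℝ) • ∑ l, (coeffMatrix m l : ℝ) • LinearMap.proj l

theorem coeff_apply (m : Fin 10) (a : Dual) :
    coeff m a = (1 / 3) * ∑ l, (coeffMatrix m l : ℝ) * a l := by
  simp [coeff]

theorem coeff_simpleRoot (m i : Fin 10) : coeff m (simpleRoot i) = if m = i then 1 else 0 := by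
  have key : ∀ m i : Fin 10,
      ∑ l, coeffMatrix m l * simpleRootInt i l = if m = i then 3 else 0 := by decide
  have h : ∑ l, (coeffMatrix m l : ℝ) * simpleRoot i l = if m = i then 3 else 0 := by
    simp only [simpleRoot]
    exact_mod_cast key m i
  rw [coeff_apply, h]
  split_ifs <;> norm_num

theorem coeff_sum_nat (m : Fin 10) (k : Fin 10 → ℕ) :
    coeff m (∑ i, k i • simpleRoot i) = k m := by
  simp only [map_sum, map_nsmul, coeff_simpleRoot]
  simp

/-- The roots are positive or negative, and the only multiples of simple roots among them are the
simple roots and their negatives. -/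
theorem IsRoot.exists_coeff {a : Dual} (ha : IsRoot a) :
    ∃ k : Fin 10 → ℕ, (∀ i, (∀ j ≠ i, k j = 0) → k i = 1) ∧
      (a = ∑ i, k i • simpleRoot i ∨ a = -∑ i, k i • simpleRoot i) := by
  have hsum : ∀ w : List (Fin 10), (∑ i, w.count i • simpleRoot i) = (w.map simpleRoot).sum := by
    intro w
    rw [Finset.sum_list_map_count]
    exact (Finset.sum_subset (Finset.subset_univ _) fun i _ hi => by
      rw [List.count_eq_zero.2 fun h => hi (List.mem_toFinset.2 h), zero_smul]).symm
  have hcor : ∀ (i : Fin 10) (w : List (Fin 10)),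
      coroot i (w.map simpleRoot).sum = ((w.map (cartanMatrix i)).sum : ℤ) := by
    intro i w
    induction w with
    | nil => simp
    | cons j w ih => simp [ih, coroot_simpleRoot]
  have hone : ∀ (u : Fin 10 → Algebra) (w : List (Fin 10)), lieWord u w ≠ 0 →
      ∀ i, (∀ j ≠ i, w.count j = 0) → w.count i = 1 := by
    intro u w hw i hi
    rw [eq_singleton_of_lieWord_ne_zero u i hw fun j hj => ?_]
    · simp
    · by_contra hji
      exact List.count_eq_zero.1 (hi j hji) hj
  obtain ⟨x, hx0, hx⟩ := exists_of_isRoot ha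
  rcases isChevalleyFamily.weight_eq lieSpan_generators hx0 hx with h | ⟨w, hw, h⟩ | ⟨w, hw, h⟩
  · exact absurd (eq_zero_of_coroot_eq_zero fun i => by simpa using congrFun h i) ha.1
  · refine ⟨fun i => w.count i, hone E w hw, Or.inl ?_⟩
    rw [hsum, ← sub_eq_zero]
    refine eq_zero_of_coroot_eq_zero fun i => ?_
    rw [map_sub, hcor, sub_eq_zero]
    exact Complex.ofReal_injective ((h i).trans (Complex.ofReal_intCast _).symm)
  · refine ⟨fun i => w.count i, hone F w hw, Or.inr ?_⟩
    rw [hsum, ← sub_eq_zero]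
    refine eq_zero_of_coroot_eq_zero fun i => ?_
    rw [map_sub, map_neg, hcor, sub_eq_zero]
    exact Complex.ofReal_injective ((h i).trans (by rw [Complex.ofReal_neg, Complex.ofReal_intCast]))

theorem coroot_sum_nat (i : Fin 10) (k : Fin 10 → ℕ) :
    coroot i (∑ j, k j • simpleRoot j) = ((∑ j, k j * cartanMatrix i j : ℤ) : ℝ) := by
  simp only [map_sum, map_nsmul, coroot_simpleRoot]
  push_cast
  simp only [nsmul_eq_mul]

theorem IsRoot.exists_coroot_eq {a : Dual} (ha : IsRoot a) (i : Fin 10) :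
    ∃ m : ℤ, coroot i a = m := by
  obtain ⟨k, -, rfl | rfl⟩ := ha.exists_coeff
  · exact ⟨_, coroot_sum_nat i k⟩
  · exact ⟨-_, by rw [map_neg, coroot_sum_nat i k, Int.cast_neg]⟩

/-! ### Reflections -/

theorem simpleReflection_apply (i : Fin 10) (a : Dual) :
    simpleReflection i a = a - coroot i a • simpleRoot i :=
  Module.reflection_apply _ (coroot_simpleRoot_self i)

theorem IsRoot.simpleReflection {a : Dual} (ha : IsRoot a) (i : Fin 10) :
    IsRoot (simpleReflection i a) := by
  have h0 : Eten.simpleReflection i a ≠ 0 := by simpa using ha.1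
  obtain ⟨m, hm⟩ := ha.exists_coroot_eq i
  rw [simpleReflection_apply] at h0 ⊢
  rw [hm] at h0 ⊢
  obtain ⟨n, rfl | rfl⟩ := m.eq_nat_or_neg
  · simp only [Int.cast_natCast] at h0 hm ⊢
    exact isRoot_sub_of_coroot_eq ha i hm le_rfl h0
  · simp only [Int.cast_neg, Int.cast_natCast, neg_smul, sub_neg_eq_add] at h0 hm ⊢
    exact isRoot_add_of_coroot_eq ha i hm le_rfl h0

theorem form_sub_smul (a s : Dual) (c : ℝ) :
    form (a - c • s) (a - c • s) = form a a - 2 * c * form a s + c ^ 2 * form s s := by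
  have h1 : ∑ i, (a - c • s) i = ∑ i, a i - c * ∑ i, s i := by
    simp [Finset.mul_sum, Finset.sum_sub_distrib]
  have h2 : ∑ i, (a - c • s) i * (a - c • s) i =
      ∑ i, a i * a i - 2 * c * ∑ i, a i * s i + c ^ 2 * ∑ i, s i * s i := by
    rw [Finset.mul_sum, Finset.mul_sum, ← Finset.sum_sub_distrib, ← Finset.sum_add_distrib]
    refine Finset.sum_congr rfl fun i _ => ?_
    simp only [Pi.sub_apply, Pi.smul_apply, smul_eq_mul]
    ring
  simp only [form, h1, h2]
  ring

theorem form_simpleRoot (i : Fin 10) : form (simpleRoot i) (simpleRoot i) = 2 :=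
  coroot_simpleRoot_self i

theorem form_simpleReflection (i : Fin 10) (a : Dual) :
    form (simpleReflection i a) (simpleReflection i a) = form a a := by
  rw [simpleReflection_apply, form_sub_smul, form_simpleRoot]
  change _ - 2 * coroot i a * coroot i a + _ = _
  ring

theorem form_weylGroup {w : Dual ≃ₗ[ℝ] Dual} (hw : w ∈ weylGroup) (a : Dual) :
    form (w a) (w a) = form a a := by
  induction hw using Subgroup.closure_induction generalizing a with
  | mem x hx =>
    obtain ⟨i, rfl⟩ := hx
    exact form_simpleReflection i a
  | one => rfl
  | mul x y _ _ hx hy => rw [LinearEquiv.mul_apply, hx, hy]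
  | inv x _ hx =>
    rw [← hx (x⁻¹ a), ← LinearEquiv.mul_apply, mul_inv_cancel]
    rfl

theorem IsRealRoot.form_eq_two {a : Dual} (ha : IsRealRoot a) : form a a = 2 := by
  obtain ⟨-, w, hw, i, h⟩ := ha
  rw [← form_weylGroup hw, h, form_simpleRoot]

theorem isRealRoot_simpleRoot (i : Fin 10) : IsRealRoot (simpleRoot i) :=
  ⟨isRoot_simpleRoot i (simpleRoot_ne_zero i), 1, one_mem _, i, rfl⟩

theorem isRealRoot_of_simpleReflection {a : Dual} (ha : IsRoot a) (i : Fin 10)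
    (h : IsRealRoot (simpleReflection i a)) : IsRealRoot a := by
  obtain ⟨-, w, hw, j, hj⟩ := h
  exact ⟨ha, w * simpleReflection i,
    mul_mem hw (Subgroup.subset_closure ⟨i, rfl⟩), j, hj⟩

/-- Imaginary roots that are positive have nonpositive square: a root of minimal height in the
orbit is in the negative of the fundamental chamber. -/
theorem form_nonpos_of_isImaginaryRoot {a : Dual} (k : Fin 10 → ℕ)
    (hk : a = ∑ i, k i • simpleRoot i) (ha : IsImaginaryRoot a) : form a a ≤ 0 := by
  induction hN : ∑ i, k i using Nat.strong_induction_on generalizing a k with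
  | _ N ih =>
    by_cases hneg : ∀ i, coroot i a ≤ 0
    · have : form a a = ∑ i, k i * coroot i a := by
        have hl : ∀ b : Dual, form b a = form a b := fun b => by
          simp only [form, mul_comm (b _)]
          ring
        let φ : Dual →ₗ[ℝ] ℝ :=
          { toFun := fun b => form b a
            map_add' := fun b c => by
              simp only [form, Pi.add_apply, add_mul, Finset.sum_add_distrib]; ring
            map_smul' := fun c b => by
              simp only [form, Pi.smul_apply, smul_eq_mul, mul_assoc, ← Finset.mul_sum,
                RingHom.id_apply]
              ring }
        change φ a = _
        nth_rw 1 [hk]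
        rw [map_sum]
        refine Finset.sum_congr rfl fun i _ => ?_
        rw [map_nsmul, nsmul_eq_mul]
        congr 1
        exact hl _
      rw [this]
      exact Finset.sum_nonpos fun i _ => mul_nonpos_of_nonneg_of_nonpos (Nat.cast_nonneg _) (hneg i)
    · push Not at hneg
      obtain ⟨i, hi⟩ := hneg
      have hr := ha.1.simpleReflection i
      have hcoef : ∀ m, coeff m (simpleReflection i a) =
          k m - if m = i then coroot i a else 0 := by
        intro m
        rw [simpleReflection_apply, map_sub, map_smul, coeff_simpleRoot, hk, coeff_sum_nat]
        simp
      obtain ⟨l, hl1, hl | hl⟩ := hr.exists_coeff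
      · rw [← form_simpleReflection i]
        have hlk : ∀ m, (l m : ℝ) = k m - if m = i then coroot i a else 0 := fun m => by
          rw [← hcoef, hl, coeff_sum_nat]
        refine ih _ ?_ l hl ⟨hr, fun h => ha.2 (isRealRoot_of_simpleReflection ha.1 i h)⟩ rfl
        rw [← hN]
        refine Finset.sum_lt_sum (fun m _ => ?_) ⟨i, Finset.mem_univ i, ?_⟩
        · have := hlk m
          split_ifs at this
          · exact_mod_cast (by linarith : (l m : ℝ) ≤ k m)
          · exact_mod_cast (by linarith : (l m : ℝ) ≤ k m)
        · have := hlk i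
          rw [if_pos rfl] at this
          exact_mod_cast (by linarith : (l i : ℝ) < k i)
      -- The reflection changes only the coefficient of `αᵢ`. If its result is negative, all other
      -- coefficients of `a` vanish, so `a = αᵢ`, which is real.
      · have hk0 : ∀ j ≠ i, k j = 0 := by
          intro j hj
          have := hcoef j
          rw [if_neg hj, hl, map_neg, coeff_sum_nat] at this
          have h1 : (0 : ℝ) ≤ l j := Nat.cast_nonneg _
          have h2 : (0 : ℝ) ≤ k j := Nat.cast_nonneg _
          exact_mod_cast (by linarith : (k j : ℝ) = 0)
        obtain ⟨k', hk'1, hk'⟩ := ha.1.exists_coeff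
        have hkk : ∀ m, (k m : ℝ) = k' m ∨ (k m : ℝ) = -k' m := by
          intro m
          rcases hk' with h | h
          · left
            rw [← coeff_sum_nat m k, ← hk, h, coeff_sum_nat]
          · right
            rw [← coeff_sum_nat m k, ← hk, h, map_neg, coeff_sum_nat]
        have hkk' : ∀ m, k m = k' m := by
          intro m
          have h1 : (0 : ℝ) ≤ k' m := Nat.cast_nonneg _
          have h2 : (0 : ℝ) ≤ k m := Nat.cast_nonneg _
          rcases hkk m with h | h
          · exact_mod_cast h
          · exact_mod_cast (by linarith : (k m : ℝ) = k' m)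
        have hki : k i = 1 := by
          rw [hkk']
          exact hk'1 i fun j hj => by rw [← hkk', hk0 j hj]
        refine absurd ?_ ha.2
        rw [hk, Finset.sum_eq_single i (fun j _ hj => by rw [hk0 j hj, zero_smul]) (by simp), hki,
          one_smul]
        exact isRealRoot_simpleRoot i

/-! ### Permutations of the coordinates -/

/-- These simple roots have coordinate sum `0`, so the correction term of the form drops out and the
reflection is the usual one of type `A`. -/
theorem simpleReflection_castSucc (i : Fin 9) (a : Dual) :
    simpleReflection i.castSucc a = a ∘ Equiv.swap i.castSucc i.succ := by
  have hs : simpleRoot i.castSucc = Pi.single i.castSucc 1 - Pi.single i.succ 1 := by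
    have : ∀ i : Fin 9, simpleRootInt i.castSucc = Pi.single i.castSucc 1 - Pi.single i.succ 1 := by
      decide
    ext j
    simp only [simpleRoot, this, Pi.sub_apply, Pi.single_apply]
    push_cast
    rfl
  have hc : coroot i.castSucc a = a i.castSucc - a i.succ := by
    change form a (simpleRoot i.castSucc) = _
    simp [form, hs, mul_sub, Finset.sum_sub_distrib, Pi.single_apply]
  have hne : i.castSucc ≠ i.succ := Fin.castSucc_lt_succ.ne
  rw [simpleReflection_apply, hc, hs]
  ext j
  rw [Function.comp_apply]
  by_cases h1 : j = i.castSucc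
  · subst h1
    simp [hne]
  · by_cases h2 : j = i.succ
    · subst h2
      simp [hne.symm]
    · simp [h1, h2, Equiv.swap_apply_of_ne_of_ne]

theorem IsRoot.comp_perm {a : Dual} (ha : IsRoot a) (s : Equiv.Perm (Fin 10)) :
    IsRoot (a ∘ s) := by
  have hs : s ∈ Submonoid.closure
      (Set.range fun i : Fin 9 => Equiv.swap i.castSucc i.succ) := by
    rw [Equiv.Perm.mclosure_swap_castSucc_succ]
    trivial
  induction hs using Submonoid.closure_induction generalizing a with
  | mem x hx =>
    obtain ⟨i, rfl⟩ := hx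
    rw [← simpleReflection_castSucc]
    exact ha.simpleReflection _
  | one => exact ha
  | mul x y _ _ hx hy => exact hy (hx ha)

/-! ### The multiples of the null root -/

theorem isRoot_of_simpleReflection_nine {a b : Dual} (ha : IsRoot a)
    (hb : b = a - (a 7 + a 8 + a 9 - (∑ i, a i) / 3) • (simpleRoot 9)) : IsRoot b := by
  have hc : coroot 9 a = a 7 + a 8 + a 9 - (∑ i, a i) / 3 := by
    change form a (simpleRoot 9) = _
    simp only [form, simpleRoot, simpleRootInt, Fin.sum_univ_succ]
    simp
    ring
  rw [hb, ← hc, ← simpleReflection_apply]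
  exact ha.simpleReflection 9

theorem simpleRoot_nine : simpleRoot 9 = ![0, 0, 0, 0, 0, 0, 0, 1, 1, 1] := by
  ext i
  fin_cases i <;> simp [simpleRoot, simpleRootInt]

/-- The vector is `nδ - α₅`. The step is a fixed product of four reflections in `α₈` and
permutations fixing the first coordinate. All of these fix `δ`, so the same product works for every
`n`. -/
theorem isRoot_null_sub_simpleRoot (n : ℕ) :
    IsRoot ![0, n, n, n, n, n, n - 1, n + 1, n, n] := by
  induction n with
  | zero =>
    convert (isRoot_simpleRoot 6 (simpleRoot_ne_zero 6)).comp_perm (Equiv.swap 6 7) using 1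
    ext i
    fin_cases i <;> simp [simpleRoot, simpleRootInt, Equiv.swap_apply_def]
  | succ n ih =>
    have h1 : IsRoot ![0, n, n, n, n, n, n, n - 1, n - 1, n - 1] := by
      have : IsRoot ![0, n, n, n, n, n, n - 1, n, n - 1, n - 1] := by
        refine isRoot_of_simpleReflection_nine ih ?_
        rw [simpleRoot_nine]
        ext i
        fin_cases i <;> simp [Fin.sum_univ_succ] <;> ring
      convert this.comp_perm (Equiv.swap 6 7) using 1
      ext i
      fin_cases i <;> simp [Equiv.swap_apply_def]
    have h2 : IsRoot ![0, n + 1, n + 1, n + 1, n, n, n, n, n, n] := by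
      have : IsRoot ![0, n, n, n, n, n, n, n + 1, n + 1, n + 1] := by
        refine isRoot_of_simpleReflection_nine h1 ?_
        rw [simpleRoot_nine]
        ext i
        fin_cases i <;> simp [Fin.sum_univ_succ] <;> ring
      convert ((this.comp_perm (Equiv.swap 1 7)).comp_perm (Equiv.swap 2 8)).comp_perm
        (Equiv.swap 3 9) using 1
      ext i
      fin_cases i <;> simp [Equiv.swap_apply_def]
    have h3 : IsRoot ![0, n, n + 1, n + 1, n + 1, n + 1, n + 1, n, n, n + 1] := by
      have : IsRoot ![0, n + 1, n + 1, n + 1, n, n, n, n + 1, n + 1, n + 1] := by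
        refine isRoot_of_simpleReflection_nine h2 ?_
        rw [simpleRoot_nine]
        ext i
        fin_cases i <;> simp [Fin.sum_univ_succ] <;> ring
      convert ((this.comp_perm (Equiv.swap 4 1)).comp_perm (Equiv.swap 5 7)).comp_perm
        (Equiv.swap 6 8) using 1
      ext i
      fin_cases i <;> simp [Equiv.swap_apply_def]
    have h4 : IsRoot ![0, n, n + 1, n + 1, n + 1, n + 1, n + 1, n + 1, n + 1, n + 2] := by
      refine isRoot_of_simpleReflection_nine h3 ?_
      rw [simpleRoot_nine]
      ext i
      fin_cases i <;> simp [Fin.sum_univ_succ] <;> ring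
    convert (h4.comp_perm (Equiv.swap 1 6)).comp_perm (Equiv.swap 9 7) using 1
    ext i
    fin_cases i <;> simp [Equiv.swap_apply_def]
    ring

/-- `nδ - α₅` pairs to `-2` with `α₅`, so its string runs up to `nδ + α₅`, and `nδ` is the middle
term. -/
theorem isRoot_null {n : ℕ} (hn : 0 < n) : IsRoot ![0, n, n, n, n, n, n, n, n, n] := by
  have h : (![0, n, n, n, n, n, n, n, n, n] : Dual) =
      (![0, n, n, n, n, n, n - 1, n + 1, n, n] : Dual) + ((1 : ℕ) : ℝ) • simpleRoot 6 := by
    ext i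
    fin_cases i <;> simp [simpleRoot, simpleRootInt]
  have h0 : (![0, n, n, n, n, n, n, n, n, n] : Dual) ≠ 0 := fun h0 => by
    have := congrFun h0 1
    simp at this
    omega
  rw [h] at h0 ⊢
  refine isRoot_add_of_coroot_eq (isRoot_null_sub_simpleRoot n) 6 (m := 2) ?_ (by norm_num) h0
  change form _ (simpleRoot 6) = _
  simp only [form, simpleRoot, simpleRootInt, Fin.sum_univ_succ]
  simp
  ring

theorem null_comp_perm_eq (n : ℕ) (s : Equiv.Perm (Fin 10)) :
    (![0, n, n, n, n, n, n, n, n, n] : Fin 10 → ℝ) ∘ s =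
      fun i => if i = s.symm 0 then 0 else (n : ℝ) := by
  have h : (![0, n, n, n, n, n, n, n, n, n] : Fin 10 → ℝ) = fun i => if i = 0 then 0 else (n : ℝ) := by
    ext i
    fin_cases i <;> rfl
  ext i
  rw [h, Function.comp_apply]
  simp only [Equiv.eq_symm_apply]

theorem form_null (n : ℕ) (j : Fin 10) :
    form (fun i => if i = j then 0 else (n : ℝ)) (fun i => if i = j then 0 else (n : ℝ)) = 0 := by
  have h1 : ∑ i, (if i = j then 0 else (n : ℝ)) = 9 * n := by
    simp [Finset.sum_ite, Finset.filter_ne', Finset.card_erase_of_mem]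
  have h2 : ∑ i, (if i = j then 0 else (n : ℝ)) * (if i = j then 0 else (n : ℝ)) = 9 * n ^ 2 := by
    simp [Finset.sum_ite, Finset.filter_ne', Finset.card_erase_of_mem, pow_two]
  rw [form, h1, h2]
  ring

theorem exists_nat_coeff_null (n : ℕ) (j : Fin 10) :
    ∃ k : Fin 10 → ℕ, (fun i => if i = j then 0 else (n : ℝ)) = ∑ i, k i • simpleRoot i := by
  -- The coefficients come from applying the inverse matrix to the all-ones vector with a `0` at
  -- `j`; the identity also confirms that division and truncation lose nothing.
  have key : ∀ j l : Fin 10, ∑ m, ((((∑ i, coeffMatrix m i) - coeffMatrix m j) / 3).toNat : ℤ) *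
      simpleRootInt m l = if l = j then 0 else 1 := by decide
  refine ⟨fun m => n * (((∑ i, coeffMatrix m i) - coeffMatrix m j) / 3).toNat, ?_⟩
  ext l
  have h : ∑ m, ((((∑ i, coeffMatrix m i) - coeffMatrix m j) / 3).toNat : ℝ) * simpleRoot m l =
      if l = j then 0 else 1 := by
    have := congrArg (Int.cast : ℤ → ℝ) (key j l)
    simp only [Int.cast_sum, Int.cast_mul, Int.cast_natCast] at this
    simp only [simpleRoot]
    rw [this]
    split_ifs <;> simp
  rw [Finset.sum_apply]
  simp only [Pi.smul_apply, nsmul_eq_mul, Nat.cast_mul, mul_assoc]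
  rw [← Finset.mul_sum, h]
  split_ifs <;> simp

/-! ### Imaginary roots with a void -/

/-- The square of `a` is the sum of squared deviations of the nine other coordinates from their
mean. -/
theorem eq_of_form_nonpos {a : Dual} {j : Fin 10} (hj : a j = 0) (h : form a a ≤ 0) :
    a = fun i => if i = j then 0 else (∑ i, a i) / 9 := by
  have hsum : ∑ i ∈ Finset.univ.erase j, (a i - (∑ i, a i) / 9) ^ 2 = form a a := by
    have h1 : ∑ i ∈ Finset.univ.erase j, a i = ∑ i, a i := Finset.sum_erase _ hj
    have h2 : ∑ i ∈ Finset.univ.erase j, a i * a i = ∑ i, a i * a i :=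
      Finset.sum_erase _ (by rw [hj, zero_mul])
    generalize hS : ∑ i, a i = S at h1
    have h3 : ∀ i, (a i - S / 9) ^ 2 = a i * a i - 2 * S / 9 * a i + S ^ 2 / 81 := fun i => by ring
    simp only [h3, Finset.sum_add_distrib, Finset.sum_sub_distrib, ← Finset.mul_sum, h1, h2, form,
      hS, Finset.sum_const, Finset.card_erase_of_mem (Finset.mem_univ j), Finset.card_univ,
      Fintype.card_fin]
    norm_num
    ring
  have hz := (Finset.sum_eq_zero_iff_of_nonneg fun i _ => sq_nonneg _).1
    (le_antisymm (hsum.trans_le h) (Finset.sum_nonneg fun i _ => sq_nonneg _))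
  ext i
  split_ifs with hij
  · rw [hij, hj]
  · have := hz i (Finset.mem_erase.2 ⟨hij, Finset.mem_univ i⟩)
    exact sub_eq_zero.1 (pow_eq_zero_iff two_ne_zero |>.1 this)

/-- The common value is an integer because it is a coordinate of a root lattice vector. It is
nonnegative because the coordinate sum is three times the coefficient of `α₈`, and nonzero because
`a` is. -/
theorem exists_null_of_isImaginaryRoot {a : Dual} (hp : IsPositiveRoot a) (hi : IsImaginaryRoot a)
    {j : Fin 10} (hj : a j = 0) :
    ∃ n : ℕ, 0 < n ∧ a = fun i => if i = j then 0 else (n : ℝ) := by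
  obtain ⟨hr, k, hk⟩ := hp
  have ha := eq_of_form_nonpos hj (form_nonpos_of_isImaginaryRoot k hk hi)
  have h9 : ∑ i, a i = 3 * k 9 := by
    have := coeff_sum_nat 9 k
    rw [← hk, coeff_apply] at this
    have hB : ∀ l, coeffMatrix 9 l = 1 := by decide
    simp only [hB, Int.cast_one, one_mul] at this
    linarith
  have hint : ∃ z : ℤ, (∑ i, a i) / 9 = z := by
    obtain ⟨i, hij⟩ := exists_ne j
    refine ⟨∑ m, k m * simpleRootInt m i, ?_⟩
    have h1 := congrFun ha i
    simp only [if_neg hij] at h1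
    rw [← h1, hk, Finset.sum_apply]
    simp [simpleRoot]
  obtain ⟨z, hz⟩ := hint
  rw [hz] at ha
  have hz0 : 0 ≤ z := by
    have : (0 : ℝ) ≤ z := by rw [← hz, h9]; positivity
    exact_mod_cast this
  lift z to ℕ using hz0
  refine ⟨z, Nat.pos_of_ne_zero ?_, by simpa using ha⟩
  rintro rfl
  exact hr.1 (ha.trans (by ext i; simp))

theorem isPositiveRoot_null {n : ℕ} (hn : 0 < n) (s : Equiv.Perm (Fin 10)) :
    IsPositiveRoot ((![0, n, n, n, n, n, n, n, n, n] : Fin 10 → ℝ) ∘ s) :=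
  ⟨(isRoot_null hn).comp_perm s, by
    rw [null_comp_perm_eq]
    exact exists_nat_coeff_null n _⟩

theorem isImaginaryRoot_null {n : ℕ} (hn : 0 < n) (s : Equiv.Perm (Fin 10)) :
    IsImaginaryRoot ((![0, n, n, n, n, n, n, n, n, n] : Fin 10 → ℝ) ∘ s) := by
  refine ⟨(isPositiveRoot_null hn s).1, fun h => ?_⟩
  have := h.form_eq_two
  rw [null_comp_perm_eq, form_null] at this
  norm_num at this

theorem voidCount_pos {a : Dual} : 0 < voidCount a ↔ ∃ j, a j = 0 :=
  Set.ncard_pos (Set.toFinite _)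

end Eten

theorem mainTheorem9 (a : Eten.Dual) :
    (Eten.IsPositiveRoot a ∧ Eten.IsImaginaryRoot a ∧ 0 < Eten.voidCount a) ↔
      ∃ n : ℕ, 0 < n ∧ ∃ s : Equiv.Perm (Fin 10),
        a = (![0, n, n, n, n, n, n, n, n, n] : Fin 10 → ℝ) ∘ s := by
  constructor
  · rintro ⟨hp, hi, hv⟩
    obtain ⟨j, hj⟩ := Eten.voidCount_pos.1 hv
    obtain ⟨n, hn, ha⟩ := Eten.exists_null_of_isImaginaryRoot hp hi hj
    refine ⟨n, hn, Equiv.swap 0 j, ?_⟩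
    rw [Eten.null_comp_perm_eq, Equiv.symm_swap, Equiv.swap_apply_left]
    exact ha
  · rintro ⟨n, hn, s, rfl⟩
    refine ⟨Eten.isPositiveRoot_null hn s, Eten.isImaginaryRoot_null hn s,
      Eten.voidCount_pos.2 ⟨s.symm 0, ?_⟩⟩
    simp

end
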